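/- Let $a_1,\dots,a_m$ be authors and $p_1,\dots,p_n$ papers, $n\ge 1$, each paper having at least one author. Let $M\in\{0,1\}^{m\times n}$ be the publication matrix ($m_{ij}=1$ iff $a_i$ wrote $p_j$), let $C\in\{0,1\}^{n\times n}$ be the citation matrix ($c_{jk}=1$ iff $p_j$ cites $p_k$), where the citation digraph has no directed cycle, and let $W$ be the $m\times n$ matrix with entries $w_{ij}=m_{ij}/\sum_{i'=1}^m m_{i'j}$. Put $$P=W(I+C^T)M^T,\qquad Q=(I+C^T)M^TW .$$ Let $x^{\langle 0\rangle}\in\mathbb R^m$ and $y^{\langle 0\rangle}\in\mathbb R^n$ be initial score vectors with all entries positive (for instance, the all-ones vectors). Let $x^{\langle k+1\rangle}$ be $Px^{\langle k\rangle}$ divided by the sum of its entries, and let $y^{\langle k+1\rangle}$ be $Qy^{\langle k\rangle}$ divided by the sum of its entries; that is, for $k\ge1$, $x^{\langle k\rangle}$ and $y^{\langle k\rangle}$ are $P^kx^{\langle 0\rangle}$ and $Q^ky^{\langle 0\rangle}$ normalized to have entry sum $1$. Then the sequences $x^{\langle k\rangle}$ and $y^{\langle k\rangle}$ converge to limits $x^\star$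 and $y^\star$. Moreover, $x^\star$ is a principal eigenvector of $P$ and $y^\star$ is a principal eigenvector of $Q$, where a principal eigenvector of a real square matrix $A$ is an eigenvector for a real eigenvalue $c\ge 0$ of $A$ such that $c>|c'|$ for every other complex eigenvalue $c'$ of $A$. Further, both $x^\star$ and $y^\star$ are entrywise non-negative and non-zero. -/

import Mathlib

/-- The 0-1 publication matrix: rows are authors, columns are papers. -/
def publicationMatrix {m n : ℕ} (wrote : Fin m → Fin n → Prop) [DecidableRel wrote] :
    Matrix (Fin m) (Fin n) ℝ :=
  Matrix.of fun i j => if wrote i j then 1 else 0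

/-- The 0-1 citation matrix: entry `(j, k)` is `1` iff paper `j` cites paper `k`. -/
def citationMatrix {n : ℕ} (cites : Fin n → Fin n → Prop) [DecidableRel cites] :
    Matrix (Fin n) (Fin n) ℝ :=
  Matrix.of fun j k => if cites j k then 1 else 0

/-- The weight matrix: each column of `M` divided by its sum (the number of authors). -/
noncomputable def weightMatrix {m n : ℕ} (M : Matrix (Fin m) (Fin n) ℝ) :
    Matrix (Fin m) (Fin n) ℝ :=
  Matrix.of fun i j => M i j / ∑ i', M i' j

/-- The author update matrix `W (I + Cᵀ) Mᵀ`. -/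
noncomputable def authorMatrix {m n : ℕ} (M : Matrix (Fin m) (Fin n) ℝ)
    (C : Matrix (Fin n) (Fin n) ℝ) : Matrix (Fin m) (Fin m) ℝ :=
  weightMatrix M * (1 + C.transpose) * M.transpose

/-- The paper update matrix `(I + Cᵀ) Mᵀ W`. -/
noncomputable def paperMatrix {m n : ℕ} (M : Matrix (Fin m) (Fin n) ℝ)
    (C : Matrix (Fin n) (Fin n) ℝ) : Matrix (Fin n) (Fin n) ℝ :=
  (1 + C.transpose) * M.transpose * weightMatrix M

/-- Divide a score vector by the sum of its entries. -/
noncomputable def normalizeScores {d : ℕ} (v : Fin d → ℝ) : Fin d → ℝ :=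
  fun i => v i / ∑ i', v i'

/-- The score iteration: apply the update matrix, then normalize, at every step. -/
noncomputable def scoreIterate {d : ℕ} (A : Matrix (Fin d) (Fin d) ℝ) (v₀ : Fin d → ℝ) :
    ℕ → Fin d → ℝ
  | 0 => v₀
  | k + 1 => normalizeScores (A.mulVec (scoreIterate A v₀ k))

/-- `v` is an eigenvector of `A` for a real eigenvalue `c ≥ 0` that strictly exceeds the modulus
of every other complex eigenvalue of `A`. -/
def IsPrincipalEigenvector {d : ℕ} (A : Matrix (Fin d) (Fin d) ℝ) (v : Fin d → ℝ) : Prop :=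
  ∃ c : ℝ, 0 ≤ c ∧ Module.End.HasEigenvector (Matrix.toLin' A) c v ∧
    ∀ z ∈ spectrum ℂ (A.map (fun a : ℝ => (a : ℂ))), z ≠ (c : ℂ) → ‖z‖ < c

/-! Write `R = (I + Cᵀ)Mᵀ`, so that `Q = R W` and `P = W R`. Since every paper has an author, `Q` is
non-negative with positive diagonal. Such a matrix is `B + ε I` with `B ≥ 0` and `ε > 0`. The
spectral radius of `B` is one of its eigenvalues (weak Perron–Frobenius,
`norm_mem_spectrum_of_forall_norm_le`), and the shift by `ε` makes it strictly dominant
(`exists_dominant_eigenvalue`).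

Let `c` be the dominant eigenvalue; it need not be semisimple. On its generalized eigenspace `Q ^ k
y` grows like `c ^ k * k.choose p` in the direction of an eigenvector, and the other components are
`o(c ^ k)`. Positivity of `y` keeps the `c`-component nonzero (`not_tendsto_pow_mulVec_div_pow`), so
the normalized orbit converges.

The author scores follow from `P ^ (k + 1) x₀ = W Q ^ k (R x₀)`: `W` preserves entry sums, and `W R`
and `R W` share their nonzero eigenvalues. -/

open Filter Topology

/-! ### Growth of operator powers on generalized eigenspaces. -/

/-- Binomial expansion of `T ^ k` on a generalized eigenvector. -/
theorem Module.End.pow_apply_of_sub_smul_pow_apply_eq_zero {V : Type*} [AddCommGroup V]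
    [Module ℂ V] (T : Module.End ℂ V) (μ : ℂ) {N : ℕ} {y : V}
    (h : ((T - μ • 1) ^ N) y = 0) {k : ℕ} (hk : N ≤ k) :
    (T ^ k) y = ∑ j ∈ Finset.range N,
      (μ ^ (k - j) * (k.choose j : ℂ)) • ((T - μ • 1) ^ j) y := by
  have hT : T = (T - μ • 1) + μ • 1 := by simp
  have hc : Commute (T - μ • 1 : Module.End ℂ V) (μ • 1) :=
    (Commute.one_right _).smul_right μ
  have hz : ∀ j, N ≤ j → ((T - μ • 1) ^ j) y = 0 := fun j hj => by
    rw [← Nat.sub_add_cancel hj, pow_add, Module.End.mul_apply, h, map_zero]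
  conv_lhs => rw [hT, hc.add_pow]
  rw [LinearMap.sum_apply, ← Finset.sum_subset (Finset.range_mono (by omega : N ≤ k + 1))]
  · refine Finset.sum_congr rfl fun j _ => ?_
    rw [smul_pow, one_pow, mul_assoc, ← nsmul_eq_mul', Module.End.mul_apply]
    simp only [LinearMap.smul_apply, Module.End.one_apply, map_smul, map_nsmul]
    rw [mul_comm, mul_smul, Nat.cast_smul_eq_nsmul]
  · intro j _ hj
    rw [mul_assoc, ← nsmul_eq_mul', Module.End.mul_apply, smul_pow, one_pow]
    simp [hz j (by simpa using hj)]

/-- After shifting `k` by `j`, this is up to a constant the general term of the convergent series `∑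
(k + j).choose j * q ^ k` with `q = μ / s`. -/
theorem tendsto_pow_sub_mul_choose_div_pow {μ : ℂ} {s : ℝ} (h : ‖μ‖ < s) (j : ℕ) :
    Tendsto (fun k : ℕ => ((s : ℂ) ^ k)⁻¹ * (μ ^ (k - j) * (k.choose j : ℂ))) atTop (𝓝 0) := by
  have hs : 0 < s := (norm_nonneg _).trans_lt h
  have hs' : (s : ℂ) ≠ 0 := by exact_mod_cast hs.ne'
  rw [← tendsto_add_atTop_iff_nat j]
  have hq : ‖μ / s‖ < 1 := by
    rw [norm_div, Complex.norm_real, Real.norm_of_nonneg hs.le, div_lt_one hs]; exact h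
  have := ((summable_choose_mul_geometric_of_norm_lt_one j hq).tendsto_atTop_zero).mul_const
    (((s : ℂ) ^ j)⁻¹)
  rw [zero_mul] at this
  refine this.congr fun k => ?_
  rw [Nat.add_sub_cancel, div_pow, pow_add]
  field_simp

section Asymptotics

variable {V : Type*} [NormedAddCommGroup V] [NormedSpace ℂ V]

theorem Module.End.tendsto_pow_apply_of_sub_smul_pow_apply_eq_zero (T : Module.End ℂ V) {μ : ℂ}
    {s : ℝ} (hμ : ‖μ‖ < s) {N : ℕ} {y : V} (h : ((T - μ • 1) ^ N) y = 0) :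
    Tendsto (fun k : ℕ => ((s : ℂ) ^ k)⁻¹ • (T ^ k) y) atTop (𝓝 0) := by
  have : Tendsto (fun k : ℕ => ∑ j ∈ Finset.range N,
      (((s : ℂ) ^ k)⁻¹ * (μ ^ (k - j) * (k.choose j : ℂ))) • ((T - μ • 1) ^ j) y) atTop
      (𝓝 (∑ j ∈ Finset.range N, (0 : ℂ) • ((T - μ • 1) ^ j) y)) :=
    tendsto_finsetSum _ fun j _ => (tendsto_pow_sub_mul_choose_div_pow hμ j).smul_const _
  simp only [zero_smul, Finset.sum_const_zero] at this
  refine this.congr' ?_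
  filter_upwards [eventually_ge_atTop N] with k hk
  rw [T.pow_apply_of_sub_smul_pow_apply_eq_zero μ h hk, Finset.smul_sum]
  simp only [mul_smul]

/-- The predicate `p` allows two uses: with every eigenvalue, and with every eigenvalue except the
dominant one. -/
theorem Module.End.tendsto_pow_apply_of_mem_iSup (T : Module.End ℂ V) [FiniteDimensional ℂ V]
    {s : ℝ} {p : ℂ → Prop} (hs : ∀ μ, T.HasEigenvalue μ → p μ → ‖μ‖ < s) {y : V}
    (hy : y ∈ ⨆ μ, ⨆ _ : p μ, T.maxGenEigenspace μ) :
    Tendsto (fun k : ℕ => ((s : ℂ) ^ k)⁻¹ • (T ^ k) y) atTop (𝓝 0) := by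
  refine Submodule.iSup_induction _ (motive := fun y =>
    Tendsto (fun k : ℕ => ((s : ℂ) ^ k)⁻¹ • (T ^ k) y) atTop (𝓝 0)) hy ?_ (by simp) ?_
  · intro μ x hx
    by_cases hp : p μ
    · simp only [hp, iSup_pos] at hx
      by_cases hx0 : x = 0
      · simp [hx0]
      obtain ⟨N, hN⟩ := (T.mem_maxGenEigenspace μ x).1 hx
      refine T.tendsto_pow_apply_of_sub_smul_pow_apply_eq_zero (hs μ ?_ hp) hN
      by_contra hne
      refine hx0 ?_
      have hinj : Function.Injective (T - μ • 1 : Module.End ℂ V) := by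
        rw [← LinearMap.ker_eq_bot, ← Module.End.eigenspace_def]
        simpa [Module.End.hasEigenvalue_iff] using hne
      have : Function.Injective (((T - μ • 1) ^ N : Module.End ℂ V)) := by
        rw [Module.End.coe_pow]; exact hinj.iterate N
      exact this (by rw [hN, map_zero])
    · have hx0 : x = 0 := by simpa [hp] using hx
      simp [hx0]
  · intro x z hx hz
    simpa using hx.add hz

theorem Module.End.tendsto_pow_apply_of_forall_norm_lt (T : Module.End ℂ V)
    [FiniteDimensional ℂ V] {s : ℝ} (hs : ∀ μ, T.HasEigenvalue μ → ‖μ‖ < s) (y : V) :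
    Tendsto (fun k : ℕ => ((s : ℂ) ^ k)⁻¹ • (T ^ k) y) atTop (𝓝 0) :=
  T.tendsto_pow_apply_of_mem_iSup (p := fun _ => True) (fun μ h _ => hs μ h)
    (by simp [T.iSup_maxGenEigenspace_eq_top])

theorem tendsto_choose_div_choose {j p : ℕ} (h : j < p) :
    Tendsto (fun k : ℕ => ((k.choose p : ℂ))⁻¹ * (k.choose j : ℂ)) atTop (𝓝 0) := by
  have ho : (fun k : ℕ => (k.choose j : ℝ)) =o[atTop] (fun k : ℕ => (k.choose p : ℝ)) :=
    (isTheta_choose j).trans_isLittleO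
      (((Asymptotics.isLittleO_pow_pow_atTop_of_lt h).comp_tendsto tendsto_natCast_atTop_atTop).trans_isTheta
        (isTheta_choose p).symm)
  have := (Complex.continuous_ofReal.tendsto 0).comp ho.tendsto_div_nhds_zero
  simpa [Function.comp_def, div_eq_inv_mul] using this

/-- Asymptotics of `T ^ k y` on the generalized eigenspace of a positive eigenvalue. -/
theorem Module.End.exists_tendsto_pow_apply_of_mem_maxGenEigenspace (T : Module.End ℂ V) {c : ℝ}
    (hc : 0 < c) {y : V} (hy : y ∈ T.maxGenEigenspace (c : ℂ)) (hy0 : y ≠ 0) :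
    ∃ (p : ℕ) (v : V), v ≠ 0 ∧ T v = (c : ℂ) • v ∧
      Tendsto (fun k : ℕ => ((c : ℂ) ^ k * (k.choose p : ℂ))⁻¹ • (T ^ k) y) atTop (𝓝 v) := by
  classical
  have hc' : (c : ℂ) ≠ 0 := by exact_mod_cast hc.ne'
  have hex := (T.mem_maxGenEigenspace (c : ℂ) y).1 hy
  set S := T - (c : ℂ) • (1 : Module.End ℂ V) with hS
  have hN := Nat.find_spec hex
  -- `p + 1` is the least exponent for which `S` kills `y`. The `j = p` term then dominates the
  -- binomial expansion, and `c ^ (k - p) / c ^ k` gives the factor `c ^ (-p)` of the limit.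
  obtain ⟨p, hp⟩ : ∃ p, Nat.find hex = p + 1 := Nat.exists_eq_succ_of_ne_zero fun h0 => by
    rw [h0] at hN; exact hy0 (by simpa using hN)
  rw [hp] at hN
  have hlast : (S ^ p) y ≠ 0 := Nat.find_min hex (by omega)
  refine ⟨p, ((c : ℂ) ^ p)⁻¹ • (S ^ p) y, smul_ne_zero (inv_ne_zero (pow_ne_zero _ hc')) hlast,
    ?_, ?_⟩
  · have h1 : S ((S ^ p) y) = 0 := by rw [← Module.End.mul_apply, ← pow_succ', hN]
    have h2 : T ((S ^ p) y) = (c : ℂ) • (S ^ p) y := by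
      rw [← sub_eq_zero]; simpa [hS] using h1
    rw [map_smul, h2, smul_comm]
  · have hlim : Tendsto (fun k : ℕ => ∑ j ∈ Finset.range (p + 1),
        (((c : ℂ) ^ j)⁻¹ * (((k.choose p : ℂ))⁻¹ * (k.choose j : ℂ))) • (S ^ j) y) atTop
        (𝓝 (∑ j ∈ Finset.range (p + 1),
          (if j = p then ((c : ℂ) ^ p)⁻¹ else 0) • (S ^ j) y)) := by
      refine tendsto_finsetSum _ fun j hj => Tendsto.smul_const ?_ _
      split_ifs with hjp
      · subst hjp
        refine tendsto_const_nhds.congr' ?_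
        filter_upwards [eventually_ge_atTop j] with k hk
        rw [inv_mul_cancel₀, mul_one]
        exact_mod_cast (Nat.choose_pos hk).ne'
      · have hlt : j < p := by have := Finset.mem_range.1 hj; omega
        simpa using (tendsto_choose_div_choose hlt).const_mul (((c : ℂ) ^ j)⁻¹)
    rw [Finset.sum_eq_single p (fun j _ hj => by simp [hj]) (by simp), if_pos rfl] at hlim
    refine hlim.congr' ?_
    filter_upwards [eventually_ge_atTop (p + 1)] with k hk
    rw [T.pow_apply_of_sub_smul_pow_apply_eq_zero (c : ℂ) hN hk, Finset.smul_sum]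
    refine Finset.sum_congr rfl fun j hj => ?_
    have hjk : j ≤ k := by have := Finset.mem_range.1 hj; omega
    rw [smul_smul]
    congr 1
    have : (c : ℂ) ^ k = c ^ (k - j) * c ^ j := by rw [← pow_add, Nat.sub_add_cancel hjk]
    rw [this, mul_inv, mul_inv]
    have := pow_ne_zero (k - j) hc'
    field_simp

/-- If `c > 0` strictly dominates every other eigenvalue of `T`, then either `T ^ k y = o(c ^ k)`
or `T ^ k y`, suitably rescaled, converges to an eigenvector for `c`. -/
theorem Module.End.exists_tendsto_pow_apply (T : Module.End ℂ V) [FiniteDimensional ℂ V] {c : ℝ}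
    (hc : 0 < c) (hdom : ∀ μ, T.HasEigenvalue μ → μ ≠ c → ‖μ‖ < c) (y : V) :
    Tendsto (fun k : ℕ => ((c : ℂ) ^ k)⁻¹ • (T ^ k) y) atTop (𝓝 0) ∨
    ∃ (p : ℕ) (v : V), v ≠ 0 ∧ T v = (c : ℂ) • v ∧
      Tendsto (fun k : ℕ => ((c : ℂ) ^ k * (k.choose p : ℂ))⁻¹ • (T ^ k) y) atTop (𝓝 v) := by
  have htop : y ∈ ⨆ μ, T.maxGenEigenspace μ := by simp [T.iSup_maxGenEigenspace_eq_top]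
  rw [iSup_split_single _ (c : ℂ)] at htop
  obtain ⟨a, ha, b, hb, rfl⟩ := Submodule.mem_sup.1 htop
  have hb' := T.tendsto_pow_apply_of_mem_iSup hdom hb
  by_cases ha0 : a = 0
  · left; simpa [ha0] using hb'
  right
  obtain ⟨p, v, hv, hTv, hlim⟩ := T.exists_tendsto_pow_apply_of_mem_maxGenEigenspace hc ha ha0
  refine ⟨p, v, hv, hTv, ?_⟩
  have hsmall : Tendsto (fun k : ℕ => ((c : ℂ) ^ k * (k.choose p : ℂ))⁻¹ • (T ^ k) b) atTop
      (𝓝 0) := by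
    refine squeeze_zero_norm (fun k => ?_) (tendsto_norm_zero.comp hb')
    simp only [Function.comp]
    rw [mul_inv, mul_comm, mul_smul, norm_smul]
    refine mul_le_of_le_one_left (norm_nonneg _) ?_
    rw [norm_inv, Complex.norm_natCast]
    -- This also covers `k < p`, where the binomial coefficient and its inverse are both `0`.
    exact Nat.cast_inv_le_one _
  simpa using hlim.add hsmall

end Asymptotics

/-! ### Perron–Frobenius theory of non-negative matrices. -/

namespace Matrix

variable {d : ℕ}

theorem toLin'_map_ofReal_apply_ofReal (A : Matrix (Fin d) (Fin d) ℝ) (y : Fin d → ℝ) :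
    toLin' (A.map (fun a : ℝ => (a : ℂ))) (fun i => (y i : ℂ)) =
      fun i => ((A *ᵥ y) i : ℂ) := by
  ext i
  simp [mulVec, dotProduct]

theorem toLin'_map_ofReal_pow_apply_ofReal (A : Matrix (Fin d) (Fin d) ℝ) (k : ℕ)
    (y : Fin d → ℝ) :
    (toLin' (A.map (fun a : ℝ => (a : ℂ))) ^ k) (fun i => (y i : ℂ)) =
      fun i => ((A ^ k *ᵥ y) i : ℂ) := by
  induction k with
  | zero => simp
  | succ k ih =>
    rw [pow_succ', Module.End.mul_apply, ih, toLin'_map_ofReal_apply_ofReal, pow_succ',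
      mulVec_mulVec]

theorem mulVec_mono_of_nonneg {m n : ℕ} {A : Matrix (Fin m) (Fin n) ℝ} (hA : ∀ i j, 0 ≤ A i j)
    {u v : Fin n → ℝ} (h : u ≤ v) : A *ᵥ u ≤ A *ᵥ v := fun i => by
  simp only [mulVec, dotProduct]
  exact Finset.sum_le_sum fun j _ => mul_le_mul_of_nonneg_left (h j) (hA i j)

theorem pow_mulVec_mono_of_nonneg {A : Matrix (Fin d) (Fin d) ℝ} (hA : ∀ i j, 0 ≤ A i j) (k : ℕ)
    {u v : Fin d → ℝ} (h : u ≤ v) : A ^ k *ᵥ u ≤ A ^ k *ᵥ v := by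
  induction k with
  | zero => simpa using h
  | succ k ih =>
    rw [pow_succ', ← mulVec_mulVec, ← mulVec_mulVec]
    exact mulVec_mono_of_nonneg hA ih

theorem pow_smul_le_pow_mulVec {A : Matrix (Fin d) (Fin d) ℝ} (hA : ∀ i j, 0 ≤ A i j) {r : ℝ}
    (hr : 0 ≤ r) {w : Fin d → ℝ} (h : r • w ≤ A *ᵥ w) (k : ℕ) : r ^ k • w ≤ A ^ k *ᵥ w := by
  induction k with
  | zero => simp
  | succ k ih =>
    calc r ^ (k + 1) • w = r ^ k • (r • w) := by rw [smul_smul, pow_succ]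
      _ ≤ r ^ k • (A *ᵥ w) := smul_le_smul_of_nonneg_left h (pow_nonneg hr k)
      _ = A *ᵥ (r ^ k • w) := (mulVec_smul _ _ _).symm
      _ ≤ A *ᵥ (A ^ k *ᵥ w) := mulVec_mono_of_nonneg hA ih
      _ = A ^ (k + 1) *ᵥ w := by rw [mulVec_mulVec, pow_succ']

/-- The moduli of an eigenvector of a non-negative matrix form a subinvariant vector. -/
theorem norm_smul_norm_le_mulVec_norm {A : Matrix (Fin d) (Fin d) ℝ} (hA : ∀ i j, 0 ≤ A i j)
    {z : ℂ} {u : Fin d → ℂ} (hu : toLin' (A.map (fun a : ℝ => (a : ℂ))) u = z • u) :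
    ‖z‖ • (fun i => ‖u i‖) ≤ A *ᵥ (fun i => ‖u i‖) := fun i => by
  have := congrArg norm (congrFun hu i)
  rw [Pi.smul_apply, norm_smul] at this
  rw [Pi.smul_apply, smul_eq_mul, ← this, toLin'_apply]
  simp only [mulVec, dotProduct]
  refine (norm_sum_le _ _).trans (Finset.sum_le_sum fun j _ => ?_)
  simp [abs_of_nonneg (hA i j)]

theorem exists_eigenvector_of_mem_spectrum {A : Matrix (Fin d) (Fin d) ℂ} {z : ℂ}
    (hz : z ∈ spectrum ℂ A) : ∃ u, toLin' A u = z • u ∧ u ≠ 0 := by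
  rw [← spectrum_toLin', ← Module.End.hasEigenvalue_iff_mem_spectrum] at hz
  obtain ⟨u, hu⟩ := hz.exists_hasEigenvector
  exact ⟨u, hu.apply_eq_smul, hu.2⟩

theorem tendsto_inv_smul_pow_mulVec {A : Matrix (Fin d) (Fin d) ℝ} {s : ℝ}
    (hs : ∀ z ∈ spectrum ℂ (A.map (fun a : ℝ => (a : ℂ))), ‖z‖ < s) (w : Fin d → ℝ) :
    Tendsto (fun k : ℕ => (s⁻¹ • A) ^ k *ᵥ w) atTop (𝓝 0) := by
  have := Module.End.tendsto_pow_apply_of_forall_norm_lt (toLin' (A.map (fun a : ℝ => (a : ℂ))))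
    (s := s) (fun μ hμ => hs μ (by
      rwa [← spectrum_toLin', ← Module.End.hasEigenvalue_iff_mem_spectrum]))
    (fun i => (w i : ℂ))
  simp only [toLin'_map_ofReal_pow_apply_ofReal] at this
  rw [tendsto_pi_nhds] at this ⊢
  intro i
  have h := (Complex.continuous_re.tendsto _).comp (this i)
  refine h.congr fun k => ?_
  simp only [Function.comp, Pi.smul_apply, smul_pow, smul_mulVec, smul_eq_mul]
  rw [← Complex.ofReal_pow, ← Complex.ofReal_inv, ← Complex.ofReal_mul, Complex.ofReal_re,
    inv_pow]

/-- Weak **Perron–Frobenius theorem**: the spectral radius of a non-negative matrix is one of its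
eigenvalues. -/
theorem norm_mem_spectrum_of_forall_norm_le {B : Matrix (Fin d) (Fin d) ℝ}
    (hB : ∀ i j, 0 ≤ B i j) {z : ℂ} (hz : z ∈ spectrum ℂ (B.map (fun a : ℝ => (a : ℂ))))
    (hmax : ∀ z' ∈ spectrum ℂ (B.map (fun a : ℝ => (a : ℂ))), ‖z'‖ ≤ ‖z‖) :
    ((‖z‖ : ℝ) : ℂ) ∈ spectrum ℂ (B.map (fun a : ℝ => (a : ℂ))) := by
  rcases eq_or_ne z 0 with rfl | hz0
  · simpa using hz
  obtain ⟨u, hu, hu0⟩ := exists_eigenvector_of_mem_spectrum hz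
  have hsub := norm_smul_norm_le_mulVec_norm hB hu
  set ρ := ‖z‖ with hρ
  have hρ0 : 0 < ρ := norm_pos_iff.2 hz0
  set w : Fin d → ℝ := fun i => ‖u i‖ with hw
  let D : ℝ → Matrix (Fin d) (Fin d) ℝ := fun t => 1 - (t / ρ) • B
  have hDcont : Continuous D := by fun_prop
  -- Put `X = (t / ρ) B`. From `X w ≥ t w` one gets `∑ X ^ k w ≥ (1 - t)⁻¹ w`, while `adj (1 - X) w
  -- = det (1 - X) ∑ X ^ k w`. The adjugate stays bounded as `t → 1`, which forces `det (D 1) = 0`.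
  have key : ∀ i, ∀ t ∈ Set.Ioo (0 : ℝ) 1,
      |(D t).det| * w i ≤ (1 - t) * |((D t).adjugate *ᵥ w) i| := by
    intro i t ⟨ht0, ht1⟩
    set X := (t / ρ) • B with hX
    have hXlim : Tendsto (fun N : ℕ => X ^ N *ᵥ w) atTop (𝓝 0) := by
      have := tendsto_inv_smul_pow_mulVec (A := B) (s := ρ / t) (fun z' hz' =>
        (hmax z' hz').trans_lt (by rw [lt_div_iff₀ ht0]; nlinarith)) w
      simpa [hX] using this
    have hXsub : t • w ≤ X *ᵥ w := by
      have := smul_le_smul_of_nonneg_left hsub (div_pos ht0 hρ0).le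
      rwa [smul_smul, div_mul_cancel₀ _ hρ0.ne', ← smul_mulVec] at this
    have hXnn : ∀ i j, 0 ≤ X i j := fun i j => mul_nonneg (div_pos ht0 hρ0).le (hB i j)
    have hgeom : Tendsto (fun N : ℕ => |(D t).det| * ((∑ k ∈ Finset.range N, t ^ k) * w i)) atTop
        (𝓝 (|(D t).det| * ((1 - t)⁻¹ * w i))) :=
      (((hasSum_geometric_of_lt_one ht0.le ht1).tendsto_sum_nat).mul_const _).const_mul _
    have hadj : Tendsto (fun N : ℕ => |((D t).adjugate *ᵥ (w - X ^ N *ᵥ w)) i|) atTop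
        (𝓝 |((D t).adjugate *ᵥ w) i|) := by
      have hc : Continuous fun v : Fin d → ℝ => |((D t).adjugate *ᵥ v) i| := by fun_prop
      have h1 : Tendsto (fun N : ℕ => w - X ^ N *ᵥ w) atTop (𝓝 w) := by
        simpa using tendsto_const_nhds.sub hXlim
      exact (hc.tendsto w).comp h1
    have hle : |(D t).det| * ((1 - t)⁻¹ * w i) ≤ |((D t).adjugate *ᵥ w) i| := by
      refine le_of_tendsto_of_tendsto' hgeom hadj fun N => ?_
      have e1 : (D t).adjugate *ᵥ (w - X ^ N *ᵥ w) =
          (D t).det • ((∑ k ∈ Finset.range N, X ^ k) *ᵥ w) := by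
        have e2 : w - X ^ N *ᵥ w = (D t * ∑ k ∈ Finset.range N, X ^ k) *ᵥ w := by
          rw [mul_neg_geom_sum, sub_mulVec, one_mulVec]
        rw [e2, mulVec_mulVec, ← mul_assoc, adjugate_mul, smul_mul_assoc, one_mul, smul_mulVec]
      rw [e1, Pi.smul_apply, smul_eq_mul, abs_mul]
      refine mul_le_mul_of_nonneg_left (le_trans ?_ (le_abs_self _)) (abs_nonneg _)
      rw [sum_mulVec, Finset.sum_apply, Finset.sum_mul]
      exact Finset.sum_le_sum fun k _ => pow_smul_le_pow_mulVec hXnn ht0.le hXsub k i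
    have h1t : 0 < 1 - t := by linarith
    calc |(D t).det| * w i = (1 - t) * (|(D t).det| * ((1 - t)⁻¹ * w i)) := by field_simp
      _ ≤ _ := mul_le_mul_of_nonneg_left hle h1t.le
  have hdet : (D 1).det = 0 := by
    obtain ⟨i, hi⟩ := Function.ne_iff.1 hu0
    have hwi : 0 < w i := norm_pos_iff.2 hi
    have hl : Continuous fun t => |(D t).det| * w i := by fun_prop
    have hr : Continuous fun t => (1 - t) * |((D t).adjugate *ᵥ w) i| := by
      have : Continuous fun t => ((D t).adjugate *ᵥ w) :=
        hDcont.matrix_adjugate.matrix_mulVec continuous_const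
      have := (continuous_apply i).comp this
      simp only [Function.comp_def] at this
      fun_prop
    have hlim := le_of_tendsto_of_tendsto (b := 𝓝[<] (1 : ℝ))
      (hl.tendsto 1 |>.mono_left nhdsWithin_le_nhds)
      (hr.tendsto 1 |>.mono_left nhdsWithin_le_nhds)
      (by filter_upwards [Ioo_mem_nhdsLT (zero_lt_one' ℝ)] with t ht using key i t ht)
    rw [sub_self, zero_mul] at hlim
    exact abs_eq_zero.1 (le_antisymm (by nlinarith [abs_nonneg (D 1).det]) (abs_nonneg _))
  rw [spectrum.mem_iff, isUnit_iff_isUnit_det]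
  have hmap : algebraMap ℂ (Matrix (Fin d) (Fin d) ℂ) (ρ : ℂ) - B.map (fun a : ℝ => (a : ℂ)) =
      Complex.ofRealHom.mapMatrix (ρ • D 1) := by
    ext i j
    simp only [D, smul_sub, smul_smul]
    rw [mul_div_cancel₀ _ hρ0.ne', one_smul]
    simp [algebraMap_matrix_apply, one_apply]
    split_ifs <;> simp
  rw [hmap, ← RingHom.map_det, det_smul, hdet]
  simp

/-- A non-negative matrix with positive diagonal has a positive eigenvalue that strictly exceeds
the modulus of every other eigenvalue. -/
theorem exists_dominant_eigenvalue (hd : 0 < d) {A : Matrix (Fin d) (Fin d) ℝ}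
    (hA : ∀ i j, 0 ≤ A i j) (hdiag : ∀ i, 0 < A i i) :
    ∃ c : ℝ, 0 < c ∧ (c : ℂ) ∈ spectrum ℂ (A.map (fun a : ℝ => (a : ℂ))) ∧
      ∀ z ∈ spectrum ℂ (A.map (fun a : ℝ => (a : ℂ))), z ≠ (c : ℂ) → ‖z‖ < c := by
  have : Nonempty (Fin d) := ⟨⟨0, hd⟩⟩
  obtain ⟨i₀, hi₀⟩ := Finite.exists_min fun i => A i i
  set ε := A i₀ i₀ with hε
  have hε0 : 0 < ε := hdiag i₀
  -- Subtracting the least diagonal entry keeps the matrix non-negative.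
  set B : Matrix (Fin d) (Fin d) ℝ := A - ε • 1 with hBdef
  have hB : ∀ i j, 0 ≤ B i j := fun i j => by
    by_cases hij : i = j
    · subst hij; simpa [hBdef] using hi₀ i
    · simpa [hBdef, one_apply, hij] using hA i j
  have hmap : A.map (fun a : ℝ => (a : ℂ)) =
      algebraMap ℂ (Matrix (Fin d) (Fin d) ℂ) (ε : ℂ) + B.map (fun a : ℝ => (a : ℂ)) := by
    ext i j
    by_cases hij : i = j
    · subst hij; simp [hBdef, algebraMap_matrix_apply]
    · simp [hBdef, algebraMap_matrix_apply, hij]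
  have hspec : ∀ z, z + (ε : ℂ) ∈ spectrum ℂ (A.map (fun a : ℝ => (a : ℂ))) ↔
      z ∈ spectrum ℂ (B.map (fun a : ℝ => (a : ℂ))) := fun z => by
    rw [hmap, spectrum.add_mem_add_iff]
  obtain ⟨z, hz, hmax⟩ := Set.exists_max_image (spectrum ℂ (B.map (fun a : ℝ => (a : ℂ)))) norm
    (finite_spectrum _) (spectrum.nonempty_of_isAlgClosed_of_finiteDimensional ℂ _)
  refine ⟨‖z‖ + ε, by positivity, ?_, fun x hx hne => ?_⟩
  · rw [Complex.ofReal_add, hspec]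
    exact norm_mem_spectrum_of_forall_norm_le hB hz hmax
  -- The spectrum of `A` lies in the disc of radius `‖z‖` about `ε`, which meets the region of
  -- modulus at least `‖z‖ + ε` only at the real point `‖z‖ + ε`.
  · have hx' : ‖x - ε‖ ≤ ‖z‖ := hmax _ ((hspec _).1 (by simpa using hx))
    by_contra! hge
    refine hne ?_
    set ρ := ‖z‖
    have hρ : 0 ≤ ρ := norm_nonneg z
    have h1 : (x.re - ε) ^ 2 + x.im ^ 2 ≤ ρ ^ 2 := by
      have := pow_le_pow_left₀ (norm_nonneg _) hx' 2
      rw [Complex.sq_norm, Complex.normSq_apply] at this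
      simp at this
      nlinarith
    have h2 : (ρ + ε) ^ 2 ≤ x.re ^ 2 + x.im ^ 2 := by
      have := pow_le_pow_left₀ (by positivity) hge 2
      rw [Complex.sq_norm, Complex.normSq_apply] at this
      nlinarith
    have h3 : ρ + ε ≤ x.re := by
      have : 0 ≤ ε * (x.re - (ρ + ε)) := by nlinarith
      linarith [nonneg_of_mul_nonneg_right this hε0]
    have h4 : x.im ^ 2 ≤ 0 := by nlinarith
    have h5 : x.re ≤ ρ + ε := by nlinarith [sq_nonneg x.im]
    refine Complex.ext ?_ ?_
    · rw [Complex.ofReal_re]; exact le_antisymm h5 h3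
    · rw [Complex.ofReal_im]; exact pow_eq_zero_iff two_ne_zero |>.1 (le_antisymm h4 (sq_nonneg _))

/-- The orbit of a positive vector under a non-negative matrix grows at least like the powers of
any eigenvalue. -/
theorem not_tendsto_pow_mulVec_div_pow {A : Matrix (Fin d) (Fin d) ℝ} (hA : ∀ i j, 0 ≤ A i j)
    {c : ℝ} (hc : 0 < c) (hmem : (c : ℂ) ∈ spectrum ℂ (A.map (fun a : ℝ => (a : ℂ))))
    {y : Fin d → ℝ} (hy : ∀ i, 0 < y i) :
    ¬ Tendsto (fun k : ℕ => ((c : ℂ) ^ k)⁻¹ •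
      (toLin' (A.map (fun a : ℝ => (a : ℂ))) ^ k) (fun i => (y i : ℂ))) atTop (𝓝 0) := by
  intro hlim
  obtain ⟨u, hu, hu0⟩ := exists_eigenvector_of_mem_spectrum hmem
  have hsub := norm_smul_norm_le_mulVec_norm hA hu
  rw [Complex.norm_real, Real.norm_of_nonneg hc.le] at hsub
  set w : Fin d → ℝ := fun i => ‖u i‖ with hw
  obtain ⟨i, hi⟩ := Function.ne_iff.1 hu0
  have hwi : 0 < w i := norm_pos_iff.2 hi
  -- `K` is chosen so that `w ≤ K y`. Then `c ^ k w ≤ A ^ k w ≤ K A ^ k y`, so `c ^ (-k) A ^ k y`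
  -- cannot vanish in the limit at an index where `w` is positive.
  set K := ∑ i, w i / y i with hK
  have hwK : w ≤ K • y := fun j => by
    have : w j / y j ≤ K := Finset.single_le_sum (f := fun i => w i / y i)
      (fun i _ => div_nonneg (norm_nonneg _) (hy i).le) (Finset.mem_univ j)
    rwa [div_le_iff₀ (hy j)] at this
  simp only [toLin'_map_ofReal_pow_apply_ofReal] at hlim
  have hre := (Complex.continuous_re.tendsto _).comp (tendsto_pi_nhds.1 hlim i)
  have hre' : Tendsto (fun k : ℕ => K * ((c ^ k)⁻¹ * (A ^ k *ᵥ y) i)) atTop (𝓝 0) := by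
    have := hre.const_mul K
    rw [Pi.zero_apply, Complex.zero_re, mul_zero] at this
    refine this.congr fun k => ?_
    simp only [Function.comp, Pi.smul_apply, smul_eq_mul]
    rw [← Complex.ofReal_pow, ← Complex.ofReal_inv, ← Complex.ofReal_mul, Complex.ofReal_re]
  refine absurd (ge_of_tendsto' hre' fun k => ?_) (not_le.2 hwi)
  have h1 := (pow_smul_le_pow_mulVec hA hc.le hsub k i).trans
    (pow_mulVec_mono_of_nonneg hA k hwK i)
  rw [mulVec_smul, Pi.smul_apply, Pi.smul_apply, smul_eq_mul, smul_eq_mul] at h1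
  have hck : 0 < c ^ k := pow_pos hc k
  calc w i = (c ^ k)⁻¹ * (c ^ k * w i) := by field_simp
    _ ≤ (c ^ k)⁻¹ * (K * (A ^ k *ᵥ y) i) := mul_le_mul_of_nonneg_left h1 (by positivity)
    _ = _ := by ring

end Matrix

/-! ### Convergence of the normalized iteration. -/

open Matrix

theorem normalizeScores_smul {d : ℕ} {a : ℝ} (ha : a ≠ 0) (v : Fin d → ℝ) :
    normalizeScores (a • v) = normalizeScores v := by
  ext i
  simp only [normalizeScores, Pi.smul_apply, smul_eq_mul, ← Finset.mul_sum]
  exact mul_div_mul_left _ _ ha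

theorem normalizeScores_eq_smul {d : ℕ} (v : Fin d → ℝ) :
    normalizeScores v = (∑ i, v i)⁻¹ • v := by
  ext i
  simp [normalizeScores, div_eq_inv_mul]

theorem sum_normalizeScores {d : ℕ} {v : Fin d → ℝ} (hv : ∑ i, v i ≠ 0) :
    ∑ i, normalizeScores v i = 1 := by
  simp only [normalizeScores, ← Finset.sum_div]
  exact div_self hv

theorem continuousAt_normalizeScores {d : ℕ} {v : Fin d → ℝ} (hv : ∑ i, v i ≠ 0) :
    ContinuousAt normalizeScores v := by
  refine continuousAt_pi.2 fun i => ?_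
  exact (continuous_apply i).continuousAt.div (by fun_prop) hv

/-- Convergence of the power iteration for a non-negative matrix with a dominant eigenvalue. -/
theorem exists_tendsto_normalizeScores_pow_mulVec {d : ℕ} {A : Matrix (Fin d) (Fin d) ℝ}
    (hA : ∀ i j, 0 ≤ A i j) {c : ℝ} (hc : 0 < c)
    (hmem : (c : ℂ) ∈ spectrum ℂ (A.map (fun a : ℝ => (a : ℂ))))
    (hdom : ∀ z ∈ spectrum ℂ (A.map (fun a : ℝ => (a : ℂ))), z ≠ (c : ℂ) → ‖z‖ < c)
    {y : Fin d → ℝ} (hy : ∀ i, 0 < y i) :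
    ∃ w : Fin d → ℝ, (∀ i, 0 ≤ w i) ∧ ∑ i, w i = 1 ∧ A *ᵥ w = c • w ∧
      Tendsto (fun k : ℕ => normalizeScores (A ^ k *ᵥ y)) atTop (𝓝 w) := by
  rcases Module.End.exists_tendsto_pow_apply (toLin' (A.map (fun a : ℝ => (a : ℂ)))) hc
    (fun μ hμ => hdom μ (by rwa [← spectrum_toLin', ← Module.End.hasEigenvalue_iff_mem_spectrum]))
    (fun i => (y i : ℂ)) with h0 | ⟨p, v, hv0, hv, hlim⟩
  · exact absurd h0 (not_tendsto_pow_mulVec_div_pow hA hc hmem hy)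
  set g : ℕ → Fin d → ℝ := fun k => (c ^ k * (k.choose p : ℝ))⁻¹ • (A ^ k *ᵥ y) with hg
  have hgc : ∀ i, Tendsto (fun k => (g k i : ℂ)) atTop (𝓝 (v i)) := fun i => by
    refine (tendsto_pi_nhds.1 hlim i).congr fun k => ?_
    rw [toLin'_map_ofReal_pow_apply_ofReal]
    simp [hg]
  -- The complex limit of real vectors is real, so the eigenvector equation descends to `ℝ`.
  have hvre : ∀ i, v i = ((v i).re : ℂ) := fun i => by
    have h := (Complex.continuous_im.tendsto _).comp (hgc i)
    have h' : (v i).im = 0 := tendsto_nhds_unique h (by simp [Function.comp_def])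
    exact Complex.ext (by simp) (by simp [h'])
  set r : Fin d → ℝ := fun i => (v i).re with hr
  have hgr : Tendsto g atTop (𝓝 r) := tendsto_pi_nhds.2 fun i => by
    simpa [Function.comp_def] using (Complex.continuous_re.tendsto _).comp (hgc i)
  have hrnn : ∀ i, 0 ≤ r i := fun i => ge_of_tendsto' (tendsto_pi_nhds.1 hgr i) fun k => by
    have h1 := pow_mulVec_mono_of_nonneg hA k (u := 0) (v := y) (fun i => (hy i).le) i
    rw [mulVec_zero] at h1
    exact mul_nonneg (by positivity) h1
  have hvr : v = fun i => (r i : ℂ) := funext hvre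
  have hr0 : 0 < ∑ i, r i := by
    refine (Finset.sum_nonneg fun i _ => hrnn i).lt_of_ne fun h => hv0 ?_
    have := (Finset.sum_eq_zero_iff_of_nonneg fun i _ => hrnn i).1 h.symm
    ext i
    rw [hvre i, show (v i).re = 0 from this i (Finset.mem_univ i)]
    simp
  have hAr : A *ᵥ r = c • r := by
    rw [hvr, toLin'_map_ofReal_apply_ofReal] at hv
    ext i
    have := congrFun hv i
    simp only [Pi.smul_apply, smul_eq_mul] at this ⊢
    exact_mod_cast this
  refine ⟨normalizeScores r, fun i => div_nonneg (hrnn i) hr0.le, sum_normalizeScores hr0.ne', ?_,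
    ?_⟩
  · rw [normalizeScores_eq_smul, mulVec_smul, hAr, smul_comm]
  · refine ((continuousAt_normalizeScores hr0.ne').tendsto.comp hgr).congr' ?_
    filter_upwards [eventually_ge_atTop p] with k hk
    refine normalizeScores_smul (inv_ne_zero (mul_ne_zero (pow_pos hc k).ne' ?_)) _
    exact_mod_cast (Nat.choose_pos hk).ne'

/-- Normalization ignores nonzero scalars, so the intermediate ones cancel. The index starts at `k +
1` because the initial vector is not normalized. -/
theorem scoreIterate_succ_eq {d : ℕ} {A : Matrix (Fin d) (Fin d) ℝ} {v : Fin d → ℝ}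
    (h : ∀ k, ∑ i, (A ^ (k + 1) *ᵥ v) i ≠ 0) (k : ℕ) :
    scoreIterate A v (k + 1) = normalizeScores (A ^ (k + 1) *ᵥ v) := by
  induction k with
  | zero => simp [scoreIterate]
  | succ k ih =>
    rw [scoreIterate, ih, normalizeScores_eq_smul (A ^ (k + 1) *ᵥ v), mulVec_smul, mulVec_mulVec,
      ← pow_succ', normalizeScores_smul (inv_ne_zero (h k))]

theorem isPrincipalEigenvector_of_mulVec_eq_smul {d : ℕ} {A : Matrix (Fin d) (Fin d) ℝ} {c : ℝ}
    (hc : 0 ≤ c) (hdom : ∀ z ∈ spectrum ℂ (A.map (fun a : ℝ => (a : ℂ))), z ≠ (c : ℂ) → ‖z‖ < c)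
    {v : Fin d → ℝ} (hv : A *ᵥ v = c • v) (hv0 : v ≠ 0) : IsPrincipalEigenvector A v :=
  ⟨c, hc, ⟨Module.End.mem_eigenspace_iff.2 (by simpa using hv), hv0⟩, hdom⟩

theorem ne_zero_of_sum_eq_one {d : ℕ} {v : Fin d → ℝ} (hv : ∑ i, v i = 1) : v ≠ 0 := by
  rintro rfl
  simp at hv

/-! ### Passing between `R * W` and `W * R`. -/

/-- A nonzero eigenvalue of `A * B` is an eigenvalue of `B * A`, for rectangular factors. -/
theorem Matrix.mem_spectrum_mul_swap {m n : ℕ} {A : Matrix (Fin m) (Fin n) ℂ}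
    {B : Matrix (Fin n) (Fin m) ℂ} {z : ℂ} (hz0 : z ≠ 0) (hz : z ∈ spectrum ℂ (A * B)) :
    z ∈ spectrum ℂ (B * A) := by
  obtain ⟨u, hu, hu0⟩ := exists_eigenvector_of_mem_spectrum hz
  rw [toLin'_apply, ← mulVec_mulVec] at hu
  rw [← spectrum_toLin', ← Module.End.hasEigenvalue_iff_mem_spectrum]
  refine Module.End.hasEigenvalue_of_hasEigenvector (x := B *ᵥ u)
    ⟨Module.End.mem_eigenspace_iff.2 ?_, fun h => ?_⟩
  · rw [toLin'_apply, ← mulVec_mulVec, hu, mulVec_smul]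
  · rw [h, mulVec_zero] at hu
    exact (smul_ne_zero hz0 hu0) hu.symm

/-- This makes `W` commute with normalization. -/
theorem sum_mulVec_of_sum_col_eq_one {m n : ℕ} {W : Matrix (Fin m) (Fin n) ℝ}
    (hW : ∀ j, ∑ i, W i j = 1) (v : Fin n → ℝ) : ∑ i, (W *ᵥ v) i = ∑ j, v j := by
  simp only [mulVec, dotProduct]
  rw [Finset.sum_comm]
  simp [← Finset.sum_mul, hW]

theorem Matrix.pow_mulVec_pos_of_diag_pos {d : ℕ} {A : Matrix (Fin d) (Fin d) ℝ}
    (hA : ∀ i j, 0 ≤ A i j) (hdiag : ∀ i, 0 < A i i) {y : Fin d → ℝ} (hy : ∀ i, 0 < y i) (k : ℕ)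
    (i : Fin d) : 0 < (A ^ k *ᵥ y) i := by
  induction k generalizing i with
  | zero => simpa using hy i
  | succ k ih =>
    rw [pow_succ', ← mulVec_mulVec]
    exact Finset.sum_pos' (fun j _ => mul_nonneg (hA i j) (ih j).le)
      ⟨i, Finset.mem_univ i, mul_pos (hdiag i) (ih i)⟩

/-- Convergence of the score iterations of `R * W` and `W * R` to principal eigenvectors, when the
columns of `W ≥ 0` have sum `1` and `R * W` is non-negative with positive diagonal. -/
theorem exists_tendsto_scoreIterate_mul {m n : ℕ} (hn : 0 < n) {W : Matrix (Fin m) (Fin n) ℝ}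
    {R : Matrix (Fin n) (Fin m) ℝ} (hW : ∀ i j, 0 ≤ W i j) (hWsum : ∀ j, ∑ i, W i j = 1)
    (hQ : ∀ i j, 0 ≤ (R * W) i j) (hdiag : ∀ j, 0 < (R * W) j j)
    {x₀ : Fin m → ℝ} (hx₀ : ∀ j, 0 < (R *ᵥ x₀) j) {y₀ : Fin n → ℝ} (hy₀ : ∀ j, 0 < y₀ j) :
    ∃ (xs : Fin m → ℝ) (ys : Fin n → ℝ),
      Tendsto (scoreIterate (W * R) x₀) atTop (𝓝 xs) ∧
      Tendsto (scoreIterate (R * W) y₀) atTop (𝓝 ys) ∧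
      IsPrincipalEigenvector (W * R) xs ∧ IsPrincipalEigenvector (R * W) ys ∧
      (∀ i, 0 ≤ xs i) ∧ xs ≠ 0 ∧ (∀ j, 0 ≤ ys j) ∧ ys ≠ 0 := by
  have : Nonempty (Fin n) := ⟨⟨0, hn⟩⟩
  obtain ⟨c, hc, hmem, hdom⟩ := exists_dominant_eigenvalue hn hQ hdiag
  have hpos : ∀ {y : Fin n → ℝ}, (∀ j, 0 < y j) → ∀ k, 0 < ∑ j, ((R * W) ^ k *ᵥ y) j :=
    fun hy k => Finset.sum_pos (fun j _ => pow_mulVec_pos_of_diag_pos hQ hdiag hy k j)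
      Finset.univ_nonempty
  obtain ⟨ys, hys, hys1, hyseig, hyslim⟩ :=
    exists_tendsto_normalizeScores_pow_mulVec hQ hc hmem hdom hy₀
  -- The author orbit is followed in paper space, starting from `R *ᵥ x₀`; its limit is carried back
  -- by `W`.
  obtain ⟨w, hw, hw1, hweig, hwlim⟩ :=
    exists_tendsto_normalizeScores_pow_mulVec hQ hc hmem hdom hx₀
  have hpow : ∀ k, (W * R) ^ (k + 1) *ᵥ x₀ = W *ᵥ ((R * W) ^ k *ᵥ (R *ᵥ x₀)) := fun k => by
    induction k with
    | zero => simp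
    | succ k ih =>
      rw [pow_succ', ← mulVec_mulVec, ih, pow_succ' (R * W)]
      simp only [mulVec_mulVec, Matrix.mul_assoc]
  have hxs1 : ∑ i, (W *ᵥ w) i = 1 := by rw [sum_mulVec_of_sum_col_eq_one hWsum, hw1]
  refine ⟨W *ᵥ w, ys, ?_, ?_, ?_, ?_, fun i => ?_, ne_zero_of_sum_eq_one hxs1, hys,
    ne_zero_of_sum_eq_one hys1⟩
  · rw [← tendsto_add_atTop_iff_nat 1]
    have hcont : Continuous fun v : Fin n → ℝ => W *ᵥ v := by fun_prop
    refine ((hcont.tendsto w).comp hwlim).congr fun k => ?_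
    rw [scoreIterate_succ_eq fun k => ?_, hpow, normalizeScores_eq_smul (W *ᵥ _),
      sum_mulVec_of_sum_col_eq_one hWsum, ← mulVec_smul, ← normalizeScores_eq_smul]
    · rfl
    · rw [hpow, sum_mulVec_of_sum_col_eq_one hWsum]
      exact (hpos hx₀ k).ne'
  · rw [← tendsto_add_atTop_iff_nat 1] at hyslim ⊢
    exact hyslim.congr fun k => (scoreIterate_succ_eq (fun k => (hpos hy₀ _).ne') k).symm
  · refine isPrincipalEigenvector_of_mulVec_eq_smul hc.le (fun z hz hne => ?_) ?_
      (ne_zero_of_sum_eq_one hxs1)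
    -- Only nonzero eigenvalues transfer between the two products; `0` is harmless because `c > 0`.
    · rcases eq_or_ne z 0 with rfl | hz0
      · simpa using hc
      refine hdom z ?_ hne
      have hmul : ∀ {a b e : ℕ} (X : Matrix (Fin a) (Fin b) ℝ) (Y : Matrix (Fin b) (Fin e) ℝ),
          (X * Y).map (fun a : ℝ => (a : ℂ)) =
            X.map (fun a : ℝ => (a : ℂ)) * Y.map (fun a : ℝ => (a : ℂ)) :=
        fun X Y => Matrix.map_mul (f := Complex.ofRealHom)
      rw [hmul] at hz ⊢
      exact mem_spectrum_mul_swap hz0 hz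
    · rw [← mulVec_smul, ← hweig]
      simp only [mulVec_mulVec, Matrix.mul_assoc]
  · exact isPrincipalEigenvector_of_mulVec_eq_smul hc.le hdom hyseig (ne_zero_of_sum_eq_one hys1)
  · have := mulVec_mono_of_nonneg hW (u := 0) (v := w) hw i
    rwa [mulVec_zero] at this

/-! ### The publication and citation matrices. -/

theorem publicationMatrix_nonneg {m n : ℕ} (wrote : Fin m → Fin n → Prop) [DecidableRel wrote]
    (i : Fin m) (j : Fin n) : 0 ≤ publicationMatrix wrote i j := by
  simp only [publicationMatrix, of_apply]
  split_ifs <;> norm_num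

theorem citationMatrix_nonneg {n : ℕ} (cites : Fin n → Fin n → Prop) [DecidableRel cites]
    (j k : Fin n) : 0 ≤ citationMatrix cites j k := by
  simp only [citationMatrix, of_apply]
  split_ifs <;> norm_num

theorem publicationMatrix_pos {m n : ℕ} {wrote : Fin m → Fin n → Prop} [DecidableRel wrote]
    {i : Fin m} {j : Fin n} (h : wrote i j) : 0 < publicationMatrix wrote i j := by
  simp [publicationMatrix, h]

/-- The identity summand alone contributes `Mᵀ`. Hence any author of a paper makes the corresponding
entry of `R` positive, which yields both the positive diagonal of `R * W` and the positivity of `R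
*ᵥ x₀`. -/
theorem le_one_add_transpose_mul_transpose {m n : ℕ} {M : Matrix (Fin m) (Fin n) ℝ}
    {C : Matrix (Fin n) (Fin n) ℝ} (hM : ∀ i j, 0 ≤ M i j) (hC : ∀ j k, 0 ≤ C j k)
    (j : Fin n) (i : Fin m) :
    M i j ≤ ((1 + C.transpose) * M.transpose : Matrix (Fin n) (Fin m) ℝ) j i := by
  rw [Matrix.add_mul, Matrix.one_mul, Matrix.add_apply, transpose_apply, mul_apply]
  exact le_add_of_nonneg_right (Finset.sum_nonneg fun k _ => mul_nonneg (hC k j) (hM i k))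

theorem theorem1 {m n : ℕ} (hn : 0 < n)
    (wrote : Fin m → Fin n → Prop) [DecidableRel wrote]
    (cites : Fin n → Fin n → Prop) [DecidableRel cites]
    (h_authored : ∀ j, ∃ i, wrote i j)
    (h_acyclic : ∀ j, ¬ Relation.TransGen cites j j)
    (x₀ : Fin m → ℝ) (hx₀ : ∀ i, 0 < x₀ i)
    (y₀ : Fin n → ℝ) (hy₀ : ∀ j, 0 < y₀ j) :
    ∃ (xs : Fin m → ℝ) (ys : Fin n → ℝ),
      Filter.Tendsto
        (scoreIterate (authorMatrix (publicationMatrix wrote) (citationMatrix cites)) x₀)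
        Filter.atTop (nhds xs) ∧
      Filter.Tendsto
        (scoreIterate (paperMatrix (publicationMatrix wrote) (citationMatrix cites)) y₀)
        Filter.atTop (nhds ys) ∧
      IsPrincipalEigenvector
        (authorMatrix (publicationMatrix wrote) (citationMatrix cites)) xs ∧
      IsPrincipalEigenvector
        (paperMatrix (publicationMatrix wrote) (citationMatrix cites)) ys ∧
      (∀ i, 0 ≤ xs i) ∧ xs ≠ 0 ∧ (∀ j, 0 ≤ ys j) ∧ ys ≠ 0 := by
  set M := publicationMatrix wrote
  set C := citationMatrix cites
  have hM : ∀ i j, 0 ≤ M i j := publicationMatrix_nonneg wrote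
  have hMR := le_one_add_transpose_mul_transpose hM (citationMatrix_nonneg cites)
  have hR : ∀ j i, 0 ≤ ((1 + C.transpose) * M.transpose : Matrix (Fin n) (Fin m) ℝ) j i :=
    fun j i => (hM i j).trans (hMR j i)
  have hMsum : ∀ j, 0 < ∑ i, M i j := fun j => by
    obtain ⟨i, hi⟩ := h_authored j
    exact Finset.sum_pos' (fun i _ => hM i j)
      ⟨i, Finset.mem_univ i, publicationMatrix_pos hi⟩
  have hW : ∀ i j, 0 ≤ weightMatrix M i j := fun i j => div_nonneg (hM i j) (hMsum j).le
  rw [authorMatrix, Matrix.mul_assoc, paperMatrix]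
  refine exists_tendsto_scoreIterate_mul hn hW (fun j => ?_)
    (fun j k => by
      rw [mul_apply]; exact Finset.sum_nonneg fun i _ => mul_nonneg (hR j i) (hW i k)) (fun j => ?_)
    (fun j => ?_) hy₀
  · simp only [weightMatrix, of_apply, ← Finset.sum_div]
    exact div_self (hMsum j).ne'
  · obtain ⟨i, hi⟩ := h_authored j
    have hMi : 0 < M i j := publicationMatrix_pos hi
    exact Finset.sum_pos' (fun i _ => mul_nonneg (hR j i) (hW i j))
      ⟨i, Finset.mem_univ i, mul_pos (hMi.trans_le (hMR j i)) (div_pos hMi (hMsum j))⟩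
  · obtain ⟨i, hi⟩ := h_authored j
    exact Finset.sum_pos' (fun i _ => mul_nonneg (hR j i) (hx₀ i).le)
      ⟨i, Finset.mem_univ i,
        mul_pos ((publicationMatrix_pos hi).trans_le (hMR j i)) (hx₀ i)⟩
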